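/- Partitions are identified with their Young diagrams. For integers $n\ge 1$, $k\ge 0$ and a partition $\lambda$, an *$n$-vacillating tableau of shape $\lambda$ and length $2k$* is a sequence of partitions $$\bigl((n)=\lambda^{(0)},\lambda^{(1/2)},\lambda^{(1)},\lambda^{(3/2)},\dots,\lambda^{(k-1/2)},\lambda^{(k)}=\lambda\bigr)$$ such that for each $j=0,1,\dots,k-1$ one has $\lambda^{(j+1/2)}\subseteq\lambda^{(j)}$ with $|\lambda^{(j)}/\lambda^{(j+1/2)}|=1$, and $\lambda^{(j+1/2)}\subseteq\lambda^{(j+1)}$ with $|\lambda^{(j+1)}/\lambda^{(j+1/2)}|=1$. Let $m_{n,k}^{\lambda}$ be the number of them, and let $\Lambda_n^k=\{\lambda\vdash n:\lambda_1\ge n-k\}$. Let $\boldsymbol{x}=(x_1,x_2,\dots)$ be infinitely many variables. Let $s_\lambda(\boldsymbol{x})=\sum_T \boldsymbol{x}^T$ be the Schur function, where $T$ ranges over the semistandard Young tableaux of shape $\lambda$ with positive integer entries and $\boldsymbol{x}^T=\prod_i x_i^{\#\{\text{entries of }T\text{ equal to }i\}}$. Let $h_0=1$, $h_r=\sum_{1\le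 i_1\le\cdots\le i_r}x_{i_1}\cdots x_{i_r}$ for $r\ge 1$, and $h_\lambda=h_{\lambda_1}h_{\lambda_2}\cdots$. Let $S(k,j)$ be the Stirling number of the second kind, the number of partitions of a $k$-element set into $j$ nonempty blocks. **Theorem.** For all integers $n\ge 1$ and $k\ge 0$, the following identity of formal power series in $\boldsymbol{x}$ with integer coefficients holds: $$\sum_{\lambda\in\Lambda_n^k} m_{n,k}^{\lambda}\,s_\lambda(\boldsymbol{x})=\sum_{j=0}^{\min(n,k)}S(k,j)\,h_{(n-j,1^j)}(\boldsymbol{x}),$$ where $(n-j,1^j)$ is the partition with one part $n-j$ followed by $j$ parts equal to $1$, and for $j=n$ it is just $(1^n)$. -/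

import Mathlib

/-! Integer partitions are represented by their Young diagrams (`YoungDiagram`): the parts of `μ` are
its row lengths `μ.rowLens`, `μ.rowLen 0` is the largest part, and `μ.card` is the size `|μ|`. -/

namespace VacTab

/-- The one-row partition `(n)`. -/
def oneRow (n : ℕ) : YoungDiagram :=
  YoungDiagram.ofRowLens [n] (List.Pairwise.sortedGE (List.pairwise_singleton _ _))

/-- The partition `(a, 1^j)`; if `a = 0` the zero part is dropped and it is `(1^j)`. -/
def hook (a j : ℕ) : YoungDiagram :=
  YoungDiagram.ofRowLens (if a = 0 then List.replicate j 1 else a :: List.replicate j 1) (by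
    apply List.Pairwise.sortedGE
    split_ifs with h
    · exact List.pairwise_replicate.2 (Or.inr le_rfl)
    · refine List.pairwise_cons.2 ⟨fun b hb => ?_, List.pairwise_replicate.2 (Or.inr le_rfl)⟩
      rw [List.eq_of_mem_replicate hb]
      exact Nat.one_le_iff_ne_zero.2 h)

/-- There are only finitely many partitions of a given size. -/
theorem finite_card_eq (n : ℕ) : {μ : YoungDiagram | μ.card = n}.Finite := by
  apply Set.Finite.of_finite_image (f := YoungDiagram.cells)
  · refine (Finset.finite_toSet (Finset.range n ×ˢ Finset.range n).powerset).subset ?_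
    rintro _ ⟨μ, rfl, rfl⟩
    simp only [Finset.coe_powerset, Set.mem_preimage, Set.mem_powerset_iff, Finset.coe_subset]
    rintro ⟨i, j⟩ h
    have h1 : (Finset.range (i + 1) ×ˢ {j}) ⊆ μ.cells := by
      rintro ⟨a, b⟩ hab
      simp only [Finset.mem_product, Finset.mem_range, Finset.mem_singleton] at hab
      exact μ.up_left_mem (by omega) hab.2.le h
    have h2 : ({i} ×ˢ Finset.range (j + 1)) ⊆ μ.cells := by
      rintro ⟨a, b⟩ hab
      simp only [Finset.mem_product, Finset.mem_range, Finset.mem_singleton] at hab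
      exact μ.up_left_mem hab.1.le (by omega) h
    have h1' := Finset.card_le_card h1
    have h2' := Finset.card_le_card h2
    simp only [Finset.card_product, Finset.card_range, Finset.card_singleton, mul_one,
      one_mul] at h1' h2'
    simp only [Finset.mem_product, Finset.mem_range, YoungDiagram.card]
    omega
  · intro μ _ ν _ h
    exact YoungDiagram.ext h

/-- `Λ_n^k`: the partitions `λ` of `n` whose largest part is at least `n - k`. -/
noncomputable def Lam (n k : ℕ) : Finset YoungDiagram :=
  ((finite_card_eq n).subset (fun _ h => h.1 :
    {μ : YoungDiagram | μ.card = n ∧ (n : ℤ) - k ≤ μ.rowLen 0} ⊆ _)).toFinset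

theorem mem_Lam {n k : ℕ} {μ : YoungDiagram} :
    μ ∈ Lam n k ↔ μ.card = n ∧ (n : ℤ) - k ≤ μ.rowLen 0 := by
  simp [Lam]

/-- An `n`-vacillating tableau of shape `μ` and length `2k`; `full j` is the partition at the integer
index `j` and `half j` is the partition at the half-integer index `j + 1/2`. -/
@[ext]
structure VacillatingTableau (n k : ℕ) (μ : YoungDiagram) where
  full : Fin (k + 1) → YoungDiagram
  half : Fin k → YoungDiagram
  full_zero : full 0 = oneRow n
  full_last : full (Fin.last k) = μ
  half_le_full : ∀ j : Fin k, half j ≤ full j.castSucc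
  card_remove : ∀ j : Fin k, ((full j.castSucc).cells \ (half j).cells).card = 1
  half_le_full_succ : ∀ j : Fin k, half j ≤ full j.succ
  card_add : ∀ j : Fin k, ((full j.succ).cells \ (half j).cells).card = 1

namespace VacillatingTableau

variable {n k : ℕ} {μ : YoungDiagram} (V : VacillatingTableau n k μ)

theorem card_full (j : Fin (k + 1)) : (V.full j).card = (oneRow n).card := by
  induction j using Fin.induction with
  | zero => rw [V.full_zero]
  | succ i ih =>
    have h1 := Finset.card_sdiff_add_card_eq_card
      (YoungDiagram.cells_subset_iff.2 (V.half_le_full i))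
    have h2 := Finset.card_sdiff_add_card_eq_card
      (YoungDiagram.cells_subset_iff.2 (V.half_le_full_succ i))
    rw [V.card_remove] at h1
    rw [V.card_add] at h2
    rw [← ih, YoungDiagram.card, YoungDiagram.card, ← h1, ← h2]

theorem card_half (j : Fin k) : (V.half j).card = (oneRow n).card - 1 := by
  have h1 := Finset.card_sdiff_add_card_eq_card
    (YoungDiagram.cells_subset_iff.2 (V.half_le_full j))
  have h2 := V.card_full j.castSucc
  rw [V.card_remove] at h1
  rw [YoungDiagram.card] at h2 ⊢
  omega

/-- There are finitely many vacillating tableaux with given parameters. -/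
instance : Finite (VacillatingTableau n k μ) := by
  have h1 : Finite {ν : YoungDiagram // ν.card = (oneRow n).card} := finite_card_eq _
  have h2 : Finite {ν : YoungDiagram // ν.card = (oneRow n).card - 1} := finite_card_eq _
  refine Finite.of_injective (β := (Fin (k + 1) → {ν : YoungDiagram // ν.card = (oneRow n).card}) ×
    (Fin k → {ν : YoungDiagram // ν.card = (oneRow n).card - 1}))
    (fun V => (fun j => ⟨V.full j, V.card_full j⟩, fun j => ⟨V.half j, V.card_half j⟩)) ?_
  intro V W h
  simp only [Prod.mk.injEq, funext_iff, Subtype.mk.injEq] at h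
  exact VacillatingTableau.ext (funext h.1) (funext h.2)

end VacillatingTableau

/-- `m_{n,k}^μ`, the number of `n`-vacillating tableaux of shape `μ` and length `2k`. -/
noncomputable def numVT (n k : ℕ) (μ : YoungDiagram) : ℕ :=
  Nat.card (VacillatingTableau n k μ)

/-- The formal power series `∑_a x^{w a}` in the variables `x_1, x_2, …`, where `a` ranges over the
type `A` and `x^d` is the monomial with exponent vector `d`: the coefficient of `x^d` is the number
of `a` with `w a = d`. (It is used only where these numbers are finite.) -/
noncomputable def formalSum {A : Type} (w : A → ℕ+ →₀ ℕ) : MvPowerSeries ℕ+ ℤ :=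
  fun d => (Nat.card {a : A // w a = d} : ℤ)

/-- Semistandard Young tableaux of shape `μ` with positive integer entries. -/
abbrev PosSSYT (μ : YoungDiagram) : Type :=
  {T : SemistandardYoungTableau μ // ∀ c ∈ μ.cells, 0 < T c.1 c.2}

/-- The exponent vector of `x^T`: its value at `i` is the number of times `i` appears in `T`. -/
noncomputable def PosSSYT.content {μ : YoungDiagram} (T : PosSSYT μ) : ℕ+ →₀ ℕ :=
  ∑ c : {c // c ∈ μ.cells}, Finsupp.single (Nat.toPNat (T.1 c.1.1 c.1.2) (T.2 c.1 c.2)) 1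

/-- The Schur function `s_μ(x) = ∑_T x^T`. -/
noncomputable def schur (μ : YoungDiagram) : MvPowerSeries ℕ+ ℤ :=
  formalSum (PosSSYT.content (μ := μ))

/-- The complete symmetric function `h_n(x) = ∑_{i_1 ≤ ⋯ ≤ i_n} x_{i_1} ⋯ x_{i_n}`. -/
noncomputable def complete (n : ℕ) : MvPowerSeries ℕ+ ℤ :=
  formalSum (fun i : {i : Fin n → ℕ+ // Monotone i} => ∑ t, Finsupp.single (i.1 t) 1)

/-- `h_μ = h_{μ_1} h_{μ_2} ⋯`, the product over the parts of `μ`. -/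
noncomputable def completePart (μ : YoungDiagram) : MvPowerSeries ℕ+ ℤ :=
  (μ.rowLens.map complete).prod

/-- A family of functions into `ℕ+` on a finite type, with the multiset of values fixed, is finite. -/
theorem finite_of_sum_single {ι : Type} [Fintype ι] (d : ℕ+ →₀ ℕ) :
    {f : ι → ℕ+ | ∑ t, Finsupp.single (f t) 1 = d}.Finite := by
  refine (Set.Finite.pi' (fun _ : ι => d.support.finite_toSet)).subset ?_
  rintro f rfl t
  simp only [Finset.mem_coe, Finsupp.mem_support_iff, Finsupp.finsetSum_apply]
  intro h
  have := Finset.sum_eq_zero_iff.1 h t (Finset.mem_univ t)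
  simp at this

/-- The coefficients of Schur functions are numbers of elements of finite sets. -/
instance {μ : YoungDiagram} (d : ℕ+ →₀ ℕ) : Finite {T : PosSSYT μ // T.content = d} := by
  have := (finite_of_sum_single (ι := {c // c ∈ μ.cells}) d).to_subtype
  refine Finite.of_injective
    (β := {f : {c // c ∈ μ.cells} → ℕ+ | ∑ t, Finsupp.single (f t) 1 = d})
    (fun T => ⟨fun c => Nat.toPNat (T.1.1 c.1.1 c.1.2) (T.1.2 c.1 c.2), T.2⟩) ?_
  rintro ⟨⟨T, hT⟩, h⟩ ⟨⟨T', hT'⟩, h'⟩ e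
  have e' := congrFun (congrArg Subtype.val e)
  simp only [Subtype.mk.injEq]
  ext i j
  by_cases hij : (i, j) ∈ μ
  · exact congrArg PNat.val (e' ⟨(i, j), hij⟩)
  · rw [T.zeros hij, T'.zeros hij]

/-- The coefficients of complete symmetric functions are numbers of elements of finite sets. -/
instance {n : ℕ} (d : ℕ+ →₀ ℕ) :
    Finite {i : {i : Fin n → ℕ+ // Monotone i} // ∑ t, Finsupp.single (i.1 t) 1 = d} := by
  have := (finite_of_sum_single (ι := Fin n) d).to_subtype
  refine Finite.of_injective (β := {f : Fin n → ℕ+ | ∑ t, Finsupp.single (f t) 1 = d})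
    (fun i => ⟨i.1.1, i.2⟩) ?_
  rintro ⟨⟨f, hf⟩, h⟩ ⟨⟨g, hg⟩, h'⟩ e
  simpa using e

end VacTab

/-!
The proof separates a combinatorial identity on Young's lattice, valid for functions on Young diagrams
with values in any abelian group, from the one fact about Schur functions that is needed.

On functions `f` of Young diagrams let `(U f) ν` be the sum of `f` over the diagrams with one cell more
than `ν`, and let `(D f) ρ` be the sum of `f` over those with one cell less than `ρ`. Peeling off the
last step of a vacillating tableau gives `∑ μ, m_{n,k}^μ f μ = ((D U)^k f) (n)`
(`sum_Lam_numVT_smul`; the tableaux of length `2k` end in `Λ_n^k` because a step shortens the first row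
by at most one). Young's lattice is a differential poset, `U D = D U + 1` on functions
(`upOp_mul_downOp`), hence `U^j D U = D U^{j+1} + j U^j`. As `(D g) (a) = g (a - 1)` for `a ≥ 1` and
`(D g) (0) = 0`, the recurrence of the Stirling numbers turns up, and
`((D U)^k f) (n) = ∑ j, S(k,j) (U^j f) (n - j)` (`downOp_mul_upOp_pow_apply_oneRow`).

For `f = s` Pieri's rule says `U s = h_1 s` (`upOp_schur`), and `s_(a) = h_a` (`schur_oneRow`), so that
`(U^j s) (n - j) = h_1^j h_{n-j}`, which is the claim.

Both the relation `U D = D U + 1` and Pieri's rule come from one local statement,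
`ncard_covers_hStrip`: for fixed `ν` and `κ`, the diagrams that are `ν` plus a cell and `κ` plus a
horizontal strip are equinumerous with those that are `κ` minus a cell and `ν` minus a horizontal strip,
except that there is one more of the former if `ν / κ` is itself a horizontal strip. Strips of one cell
give the commutation relation. Pieri's rule follows by induction on the number of variables, since
removing the cells with the largest entry of a semistandard tableau removes a horizontal strip
(`kostka_branching`).
-/

namespace VacTab

/-! ### Young diagrams and their row lengths -/

theorem rowLen_eq_of_forall {μ : YoungDiagram} {i a : ℕ} (h : ∀ j, (i, j) ∈ μ ↔ j < a) :
    μ.rowLen i = a :=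
  eq_of_forall_lt_iff fun j => by rw [← YoungDiagram.mem_iff_lt_rowLen, h]

theorem eq_of_rowLen_eq {μ ν : YoungDiagram} (h : ∀ i, μ.rowLen i = ν.rowLen i) : μ = ν := by
  ext ⟨i, j⟩
  simp only [YoungDiagram.mem_cells, YoungDiagram.mem_iff_lt_rowLen, h]

theorem le_iff_rowLen_le {μ ν : YoungDiagram} : μ ≤ ν ↔ ∀ i, μ.rowLen i ≤ ν.rowLen i := by
  constructor
  · intro h i
    by_contra! hlt
    have : (i, ν.rowLen i) ∈ ν := h (YoungDiagram.mem_iff_lt_rowLen.2 hlt)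
    exact lt_irrefl _ (YoungDiagram.mem_iff_lt_rowLen.1 this)
  · rintro h ⟨i, j⟩ hij
    exact YoungDiagram.mem_iff_lt_rowLen.2 ((YoungDiagram.mem_iff_lt_rowLen.1 hij).trans_le (h i))

theorem exists_rowLen_eq_zero (μ : YoungDiagram) : ∃ N, μ.rowLen N = 0 := by
  refine ⟨μ.colLen 0, ?_⟩
  by_contra h
  exact lt_irrefl _ (YoungDiagram.mem_iff_lt_colLen.1
    (YoungDiagram.mem_iff_lt_rowLen.2 (Nat.pos_of_ne_zero h)))

theorem exists_forall_rowLen_eq {f : ℕ → ℕ} (hf : Antitone f) {N : ℕ} (hN : f N = 0) :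
    ∃ μ : YoungDiagram, ∀ i, μ.rowLen i = f i := by
  refine ⟨⟨(Finset.range N ×ˢ Finset.range (f 0)).filter fun c => c.2 < f c.1, ?_⟩, fun i => ?_⟩
  · rintro ⟨i, j⟩ ⟨i', j'⟩ ⟨h1 : i' ≤ i, h2 : j' ≤ j⟩ h
    simp only [Finset.coe_filter, Finset.mem_product, Finset.mem_range, Set.mem_ofPred_eq] at h ⊢
    have := hf h1
    omega
  · refine rowLen_eq_of_forall fun j => ?_
    rw [← YoungDiagram.mem_cells]
    simp only [Finset.mem_filter, Finset.mem_product, Finset.mem_range, and_iff_right_iff_imp]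
    intro h
    have h0 := hf (Nat.zero_le i)
    refine ⟨?_, by omega⟩
    by_contra! hi
    have := hf hi
    omega

theorem rowLen_oneRow (n i : ℕ) : (oneRow n).rowLen i = if i = 0 then n else 0 := by
  refine rowLen_eq_of_forall fun j => ?_
  rw [oneRow, YoungDiagram.mem_ofRowLens]
  rcases i with _ | i <;> simp

theorem card_oneRow (n : ℕ) : (oneRow n).card = n := by
  have : (oneRow n).cells = ({0} : Finset ℕ) ×ˢ Finset.range n := by
    ext ⟨i, j⟩
    rw [YoungDiagram.mem_cells, YoungDiagram.mem_iff_lt_rowLen, rowLen_oneRow]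
    rcases i with _ | i <;> simp
  rw [YoungDiagram.card, this]
  simp

/-- `Covers ν ρ`: the diagram `ρ` is obtained from `ν` by adding one cell. -/
def Covers (ν ρ : YoungDiagram) : Prop :=
  ν ≤ ρ ∧ (ρ.cells \ ν.cells).card = 1

theorem covers_iff {ν ρ : YoungDiagram} :
    Covers ν ρ ↔ ∃ i, ∀ j, ρ.rowLen j = ν.rowLen j + if j = i then 1 else 0 := by
  constructor
  · rintro ⟨hle, hcard⟩
    obtain ⟨⟨i, c⟩, hc⟩ := Finset.card_eq_one.1 hcard
    have key : ∀ j x, (x < ρ.rowLen j ∧ ¬ x < ν.rowLen j) ↔ (j = i ∧ x = c) := by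
      intro j x
      have := congrArg ((j, x) ∈ ·) hc
      simpa [YoungDiagram.mem_iff_lt_rowLen] using this
    have hle' := le_iff_rowLen_le.1 hle
    refine ⟨i, fun j => ?_⟩
    have h1 := key j (ν.rowLen j)
    have h2 := key j (ν.rowLen j + 1)
    have h3 := key j c
    have h4 := hle' j
    split_ifs with h
    · subst h
      simp only [true_and, iff_true, lt_self_iff_false, not_false_iff, and_true] at h1 h2 h3
      omega
    · simp only [h, false_and, iff_false] at h1
      omega
  · rintro ⟨i, h⟩
    refine ⟨le_iff_rowLen_le.2 fun j => by rw [h]; omega, ?_⟩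
    rw [Finset.card_eq_one]
    refine ⟨(i, ν.rowLen i), ?_⟩
    ext ⟨j, x⟩
    simp only [Finset.mem_sdiff, YoungDiagram.mem_cells, YoungDiagram.mem_iff_lt_rowLen, h,
      Finset.mem_singleton, Prod.mk.injEq]
    by_cases hj : j = i
    · subst hj; simp; omega
    · simp [hj]

theorem Covers.card_eq {ν ρ : YoungDiagram} (h : Covers ν ρ) : ρ.card = ν.card + 1 := by
  have := Finset.card_sdiff_add_card_eq_card (YoungDiagram.cells_subset_iff.2 h.1)
  rw [h.2] at this
  rw [YoungDiagram.card, YoungDiagram.card]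
  omega

/-- `HStrip κ ρ`: the skew diagram `ρ / κ` is a horizontal strip, that is, `κ ⊆ ρ` and no cell of
`ρ / κ` lies directly above another cell of `ρ`. -/
def HStrip (κ ρ : YoungDiagram) : Prop :=
  κ ≤ ρ ∧ ∀ i j, (i + 1, j) ∈ ρ → (i, j) ∈ κ

theorem hStrip_iff {κ ρ : YoungDiagram} :
    HStrip κ ρ ↔ ∀ i, κ.rowLen i ≤ ρ.rowLen i ∧ ρ.rowLen (i + 1) ≤ κ.rowLen i := by
  rw [HStrip, le_iff_rowLen_le, forall_and]
  refine and_congr_right fun _ => forall_congr' fun i => ?_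
  simp only [YoungDiagram.mem_iff_lt_rowLen]
  exact ⟨fun h => le_of_forall_lt h, fun h j hj => hj.trans_le h⟩

theorem HStrip.card_le {κ ρ : YoungDiagram} (h : HStrip κ ρ) : κ.card ≤ ρ.card :=
  Finset.card_le_card (YoungDiagram.cells_subset_iff.2 h.1)

theorem HStrip.refl (μ : YoungDiagram) : HStrip μ μ :=
  ⟨le_rfl, fun _ _ h => μ.up_left_mem (Nat.le_succ _) le_rfl h⟩

theorem Covers.hStrip {ν ρ : YoungDiagram} (h : Covers ν ρ) : HStrip ν ρ := by
  obtain ⟨i, hi⟩ := covers_iff.1 h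
  rw [hStrip_iff]
  intro j
  have h1 := hi j
  have h2 := hi (j + 1)
  have h3 := ν.rowLen_anti j (j + 1) (Nat.le_succ j)
  have h4 := ρ.rowLen_anti j (j + 1) (Nat.le_succ j)
  split_ifs at h1 h2 <;> omega

theorem covers_of_le_of_card {ν ρ : YoungDiagram} (h : ν ≤ ρ) (hc : ρ.card = ν.card + 1) :
    Covers ν ρ := by
  refine ⟨h, ?_⟩
  have := Finset.card_sdiff_add_card_eq_card (YoungDiagram.cells_subset_iff.2 h)
  rw [YoungDiagram.card, YoungDiagram.card] at hc
  omega

theorem finite_card_le (n : ℕ) : {μ : YoungDiagram | μ.card ≤ n}.Finite := by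
  have : {μ : YoungDiagram | μ.card ≤ n} = ⋃ i ∈ Set.Iic n, {μ | μ.card = i} := by
    ext μ; simp
  rw [this]
  exact (Set.finite_Iic n).biUnion fun i _ => finite_card_eq i

/-- The diagrams obtained from `ν` by adding one cell. -/
noncomputable def up (ν : YoungDiagram) : Finset YoungDiagram :=
  ((finite_card_le (ν.card + 1)).subset (fun _ h => (Covers.card_eq h).le :
    {ρ | Covers ν ρ} ⊆ _)).toFinset

/-- The diagrams obtained from `ρ` by removing one cell. -/
noncomputable def down (ρ : YoungDiagram) : Finset YoungDiagram :=
  ((finite_card_le ρ.card).subset (fun _ h => (Covers.hStrip h).card_le :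
    {ν | Covers ν ρ} ⊆ _)).toFinset

/-- The diagrams obtained from `ρ` by removing a horizontal strip. -/
noncomputable def strips (ρ : YoungDiagram) : Finset YoungDiagram :=
  ((finite_card_le ρ.card).subset (fun _ h => HStrip.card_le h :
    {κ | HStrip κ ρ} ⊆ _)).toFinset

@[simp] theorem mem_up {ν ρ : YoungDiagram} : ρ ∈ up ν ↔ Covers ν ρ := by simp [up]
@[simp] theorem mem_down {ν ρ : YoungDiagram} : ν ∈ down ρ ↔ Covers ν ρ := by simp [down]
@[simp] theorem mem_strips {κ ρ : YoungDiagram} : κ ∈ strips ρ ↔ HStrip κ ρ := by simp [strips]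

/-! ### Commuting the addition of a cell with the removal of a horizontal strip -/

open Classical in
/-- The count behind both the commutation relation of Young's lattice and Pieri's rule, in terms of
row lengths `a` of `ν` and `b` of `κ`. If `b` interlaces `a`, the admissible rows on the left are `0`
and the successors of those on the right; otherwise both sides allow only the single row, if any, in
which `b` exceeds `a`. -/
theorem ncard_interlacing {a b : ℕ → ℕ} (ha : Antitone a) (hb : Antitone b) {N : ℕ} (hN : b N = 0) :
    {i | ∀ j, b j ≤ a j + (if j = i then 1 else 0) ∧
        a (j + 1) + (if j + 1 = i then 1 else 0) ≤ b j}.ncard =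
      {i | 1 ≤ b i ∧ ∀ j, b j ≤ a j + (if j = i then 1 else 0) ∧
        a (j + 1) + (if j = i then 1 else 0) ≤ b j}.ncard +
      if ∀ j, b j ≤ a j ∧ a (j + 1) ≤ b j then 1 else 0 := by
  split_ifs with h
  · have hfin : {i | 1 ≤ b i ∧ ∀ j, b j ≤ a j + (if j = i then 1 else 0) ∧
        a (j + 1) + (if j = i then 1 else 0) ≤ b j}.Finite := by
      refine (Set.finite_Iio N).subset fun i hi => ?_
      by_contra! hle
      have := hb (not_lt.1 hle)
      have := hi.1
      omega
    rw [← Set.ncard_image_of_injective {i | 1 ≤ b i ∧ _} Nat.succ_injective,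
      ← Set.ncard_insert_of_notMem (a := 0) (by simp) (hfin.image _)]
    congr 1
    ext i
    simp only [Set.mem_ofPred_eq, Set.mem_insert_iff, Set.mem_image]
    constructor
    · intro hi
      rcases i with _ | i
      · exact Or.inl rfl
      · refine Or.inr ⟨i, ⟨?_, fun j => ⟨by have := (h j).1; omega, ?_⟩⟩, rfl⟩
        · have := (hi i).2
          simp only [if_true] at this
          omega
        · have := (hi j).2
          simpa using this
    · rintro (rfl | ⟨i, hi, rfl⟩) j
      · exact ⟨by have := (h j).1; omega, by simpa using (h j).2⟩
      · exact ⟨by have := (h j).1; omega, by simpa using (hi.2 j).2⟩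
  · rw [add_zero]
    congr 1
    ext i
    simp only [Set.mem_ofPred_eq]
    have hex : (∀ j, b j ≤ a j + (if j = i then 1 else 0)) → (∀ j, a (j + 1) ≤ b j) →
        a i < b i := by
      intro h1 h2
      by_contra! hlt
      refine h fun j => ⟨?_, h2 j⟩
      have := h1 j
      split_ifs at this with hj
      · exact hj ▸ hlt
      · exact this
    constructor
    · intro hi
      have hlt := hex (fun j => (hi j).1) (fun j => by have := (hi j).2; omega)
      refine ⟨by omega, fun j => ⟨(hi j).1, ?_⟩⟩
      split_ifs with hj
      · subst hj
        have := ha (Nat.le_succ j)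
        simp only [Nat.succ_eq_add_one] at this
        omega
      · have := (hi j).2
        omega
    · rintro ⟨-, hi⟩ j
      have hlt := hex (fun j => (hi j).1) (fun j => by have := (hi j).2; omega)
      refine ⟨(hi j).1, ?_⟩
      split_ifs with hj
      · subst hj
        have h1 := hb (Nat.le_succ j)
        simp only [Nat.succ_eq_add_one] at h1
        omega
      · have := (hi j).2
        omega

open Classical in
theorem ncard_covers_hStrip (ν κ : YoungDiagram) :
    {ρ | Covers ν ρ ∧ HStrip κ ρ}.ncard =
      {μ | HStrip μ ν ∧ Covers μ κ}.ncard + if HStrip κ ν then 1 else 0 := by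
  have ha : Antitone ν.rowLen := fun i j h => ν.rowLen_anti i j h
  have hb : Antitone κ.rowLen := fun i j h => κ.rowLen_anti i j h
  obtain ⟨N, hN⟩ := exists_rowLen_eq_zero κ
  obtain ⟨N', hN'⟩ := exists_rowLen_eq_zero ν
  have key := ncard_interlacing ha hb hN
  have h1 : {i | ∀ j, κ.rowLen j ≤ ν.rowLen j + (if j = i then 1 else 0) ∧
        ν.rowLen (j + 1) + (if j + 1 = i then 1 else 0) ≤ κ.rowLen j}.ncard =
      {ρ | Covers ν ρ ∧ HStrip κ ρ}.ncard := by
    have hex : ∀ i ∈ {i | ∀ j, κ.rowLen j ≤ ν.rowLen j + (if j = i then 1 else 0) ∧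
        ν.rowLen (j + 1) + (if j + 1 = i then 1 else 0) ≤ κ.rowLen j},
        ∃ ρ : YoungDiagram, ∀ j, ρ.rowLen j = ν.rowLen j + if j = i then 1 else 0 := by
      intro i hi
      refine exists_forall_rowLen_eq (N := N' + i + 1) (antitone_nat_of_succ_le fun j =>
        (hi j).2.trans (hi j).1) ?_
      have := ha (show N' ≤ N' + i + 1 by omega)
      rw [if_neg (by omega)]
      omega
    choose! F hF using hex
    refine Set.ncard_congr (fun i _ => F i) ?_ ?_ ?_
    · intro i hi
      refine ⟨covers_iff.2 ⟨i, hF i hi⟩, hStrip_iff.2 fun j => ?_⟩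
      rw [hF i hi, hF i hi]
      exact hi j
    · intro i i' hi hi' h
      have e1 := hF i hi i
      rw [h, hF i' hi' i, if_pos rfl] at e1
      by_contra hne
      rw [if_neg hne] at e1
      omega
    · rintro ρ ⟨hρ, hs⟩
      obtain ⟨i, hi⟩ := covers_iff.1 hρ
      have hmem : ∀ j, κ.rowLen j ≤ ν.rowLen j + (if j = i then 1 else 0) ∧
          ν.rowLen (j + 1) + (if j + 1 = i then 1 else 0) ≤ κ.rowLen j := by
        intro j
        have := hStrip_iff.1 hs j
        rwa [hi, hi] at this
      exact ⟨i, hmem, eq_of_rowLen_eq fun j => by rw [hF i hmem, hi]⟩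
  have h2 : {i | 1 ≤ κ.rowLen i ∧ ∀ j, κ.rowLen j ≤ ν.rowLen j + (if j = i then 1 else 0) ∧
        ν.rowLen (j + 1) + (if j = i then 1 else 0) ≤ κ.rowLen j}.ncard =
      {μ | HStrip μ ν ∧ Covers μ κ}.ncard := by
    have hex : ∀ i ∈ {i | 1 ≤ κ.rowLen i ∧
        ∀ j, κ.rowLen j ≤ ν.rowLen j + (if j = i then 1 else 0) ∧
        ν.rowLen (j + 1) + (if j = i then 1 else 0) ≤ κ.rowLen j},
        ∃ μ : YoungDiagram, ∀ j, κ.rowLen j = μ.rowLen j + if j = i then 1 else 0 := by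
      rintro i ⟨hpos, hi⟩
      obtain ⟨μ, hμ⟩ := exists_forall_rowLen_eq (f := fun j => κ.rowLen j - if j = i then 1 else 0)
        (N := N) (antitone_nat_of_succ_le fun j => by
          have := (hi j).2
          have := (hi (j + 1)).1
          omega) (by omega)
      refine ⟨μ, fun j => ?_⟩
      rw [hμ]
      split_ifs with hj
      · subst hj; omega
      · omega
    choose! F hF using hex
    refine Set.ncard_congr (fun i _ => F i) ?_ ?_ ?_
    · intro i hi
      refine ⟨hStrip_iff.2 fun j => ?_, covers_iff.2 ⟨i, hF i hi⟩⟩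
      have e1 := hi.2 j
      rw [hF i hi] at e1
      omega
    · intro i i' hi hi' h
      have e1 := hF i hi i
      rw [h, hF i' hi' i, if_pos rfl] at e1
      by_contra hne
      rw [if_neg hne] at e1
      omega
    · rintro μ ⟨hs, hμ⟩
      obtain ⟨i, hi⟩ := covers_iff.1 hμ
      have hmem : 1 ≤ κ.rowLen i ∧ ∀ j, κ.rowLen j ≤ ν.rowLen j + (if j = i then 1 else 0) ∧
          ν.rowLen (j + 1) + (if j = i then 1 else 0) ≤ κ.rowLen j := by
        refine ⟨by rw [hi, if_pos rfl]; omega, fun j => ?_⟩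
        have := hStrip_iff.1 hs j
        rw [hi]
        omega
      exact ⟨i, hmem, eq_of_rowLen_eq fun j => by
        have := hF i hmem j
        rw [hi] at this
        omega⟩
  rw [← h1, ← h2, key, hStrip_iff]

/-- Adding a cell and then removing a horizontal strip amounts to doing these in the other order, or
to removing a horizontal strip and adding nothing. -/
theorem sum_up_sum_strips {M : Type*} [AddCommMonoid M] (f : YoungDiagram → M)
    (ν : YoungDiagram) :
    ∑ ρ ∈ up ν, ∑ κ ∈ strips ρ, f κ =
      ∑ μ ∈ strips ν, ∑ κ ∈ up μ, f κ + ∑ κ ∈ strips ν, f κ := by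
  classical
  set B := (finite_card_le (ν.card + 1)).toFinset with hB
  have mB : ∀ κ, κ ∈ B ↔ κ.card ≤ ν.card + 1 := fun κ => by simp [hB]
  have e1 : ∑ ρ ∈ up ν, ∑ κ ∈ strips ρ, f κ =
      ∑ κ ∈ B, ∑ ρ ∈ (up ν).filter (HStrip κ), f κ := by
    refine Finset.sum_comm' fun ρ κ => ?_
    simp only [mem_up, mem_strips, Finset.mem_filter, mB]
    exact ⟨fun h => ⟨h, h.1.card_eq ▸ h.2.card_le⟩, fun h => h.1⟩
  have e2 : ∑ μ ∈ strips ν, ∑ κ ∈ up μ, f κ =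
      ∑ κ ∈ B, ∑ μ ∈ (strips ν).filter (Covers · κ), f κ := by
    refine Finset.sum_comm' fun μ κ => ?_
    simp only [mem_up, mem_strips, Finset.mem_filter, mB]
    refine ⟨fun h => ⟨h, ?_⟩, fun h => h.1⟩
    have := h.1.card_le
    have := h.2.card_eq
    omega
  have e3 : ∑ κ ∈ strips ν, f κ = ∑ κ ∈ B, if HStrip κ ν then f κ else 0 := by
    rw [← Finset.sum_filter]
    refine Finset.sum_congr ?_ fun _ _ => rfl
    ext κ
    simp only [mem_strips, Finset.mem_filter, mB]
    exact ⟨fun h => ⟨h.card_le.trans (Nat.le_succ _), h⟩, fun h => h.2⟩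
  rw [e1, e2, e3, ← Finset.sum_add_distrib]
  refine Finset.sum_congr rfl fun κ _ => ?_
  have key := ncard_covers_hStrip ν κ
  have c1 : {ρ | Covers ν ρ ∧ HStrip κ ρ} = ((up ν).filter (HStrip κ) : Set _) := by
    ext; simp
  have c2 : {μ | HStrip μ ν ∧ Covers μ κ} = ((strips ν).filter (Covers · κ) : Set _) := by
    ext; simp
  rw [c1, c2, Set.ncard_coe_finset, Set.ncard_coe_finset] at key
  rw [Finset.sum_const, Finset.sum_const, key, add_smul]
  split_ifs <;> simp

theorem sum_up_sum_down {M : Type*} [AddCommMonoid M] (f : YoungDiagram → M)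
    (ν : YoungDiagram) :
    ∑ ρ ∈ up ν, ∑ κ ∈ down ρ, f κ = ∑ μ ∈ down ν, ∑ κ ∈ up μ, f κ + f ν := by
  classical
  -- the strips of size one are singled out by restricting `f` to the diagrams of the size of `ν`
  have key := sum_up_sum_strips (fun κ => if κ.card = ν.card then f κ else 0) ν
  have e1 : ∑ ρ ∈ up ν, ∑ κ ∈ strips ρ, (if κ.card = ν.card then f κ else 0) =
      ∑ ρ ∈ up ν, ∑ κ ∈ down ρ, f κ := by
    refine Finset.sum_congr rfl fun ρ hρ => ?_
    rw [← Finset.sum_filter]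
    refine Finset.sum_congr ?_ fun _ _ => rfl
    have hc := (mem_up.1 hρ).card_eq
    ext κ
    simp only [Finset.mem_filter, mem_strips, mem_down]
    refine ⟨fun h => covers_of_le_of_card h.1.1 (by omega), fun h => ⟨h.hStrip, ?_⟩⟩
    have := h.card_eq
    omega
  have e2 : ∑ μ ∈ strips ν, ∑ κ ∈ up μ, (if κ.card = ν.card then f κ else 0) =
      ∑ μ ∈ down ν, ∑ κ ∈ up μ, f κ := by
    have : ∀ μ, ∑ κ ∈ up μ, (if κ.card = ν.card then f κ else 0) =
        if μ.card + 1 = ν.card then ∑ κ ∈ up μ, f κ else 0 := by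
      intro μ
      split_ifs with h
      · exact Finset.sum_congr rfl fun κ hκ => if_pos ((mem_up.1 hκ).card_eq.trans h)
      · exact Finset.sum_eq_zero fun κ hκ => if_neg fun h' => h ((mem_up.1 hκ).card_eq ▸ h')
    simp only [this]
    rw [← Finset.sum_filter]
    refine Finset.sum_congr ?_ fun _ _ => rfl
    ext μ
    simp only [Finset.mem_filter, mem_strips, mem_down]
    exact ⟨fun h => covers_of_le_of_card h.1.1 h.2.symm, fun h => ⟨h.hStrip, h.card_eq.symm⟩⟩
  have e3 : ∑ κ ∈ strips ν, (if κ.card = ν.card then f κ else 0) = f ν := by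
    rw [Finset.sum_eq_single ν]
    · simp
    · intro κ hκ hne
      refine if_neg fun hc => hne (YoungDiagram.ext ?_)
      exact Finset.eq_of_subset_of_card_le
        (YoungDiagram.cells_subset_iff.2 (mem_strips.1 hκ).1) hc.ge
    · intro h
      exact absurd (mem_strips.2 (HStrip.refl ν)) h
  rw [e1, e2, e3] at key
  exact key

/-! ### Up and down operators on Young's lattice -/

variable {M : Type*} [AddCommGroup M]

/-- The operator on functions of Young diagrams that sums over the diagrams with one more cell. -/
noncomputable def upOp (M : Type*) [AddCommGroup M] : Module.End ℤ (YoungDiagram → M) where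
  toFun f ν := ∑ ρ ∈ up ν, f ρ
  map_add' _ _ := funext fun _ => Finset.sum_add_distrib
  map_smul' c _ := funext fun _ => (Finset.smul_sum (r := c)).symm

/-- The operator on functions of Young diagrams that sums over the diagrams with one cell less. -/
noncomputable def downOp (M : Type*) [AddCommGroup M] : Module.End ℤ (YoungDiagram → M) where
  toFun f ρ := ∑ ν ∈ down ρ, f ν
  map_add' _ _ := funext fun _ => Finset.sum_add_distrib
  map_smul' c _ := funext fun _ => (Finset.smul_sum (r := c)).symm

theorem upOp_apply (f : YoungDiagram → M) (ν : YoungDiagram) :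
    upOp M f ν = ∑ ρ ∈ up ν, f ρ := rfl

theorem downOp_apply (f : YoungDiagram → M) (ρ : YoungDiagram) :
    downOp M f ρ = ∑ ν ∈ down ρ, f ν := rfl

/-- Young's lattice is a differential poset. -/
theorem upOp_mul_downOp : upOp M * downOp M = downOp M * upOp M + 1 := by
  ext f ν
  exact sum_up_sum_down f ν

theorem upOp_pow_mul_downOp_mul_upOp (j : ℕ) :
    upOp M ^ j * (downOp M * upOp M) = downOp M * upOp M ^ (j + 1) + j • upOp M ^ j := by
  induction j with
  | zero => simp
  | succ j ih =>
    rw [pow_succ' _ j, mul_assoc, ih, mul_add, ← mul_assoc, upOp_mul_downOp, add_mul, one_mul,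
      mul_assoc, mul_smul_comm, ← pow_succ', ← pow_succ', succ_nsmul', add_assoc]

theorem down_oneRow_zero : down (oneRow 0) = ∅ := by
  refine Finset.eq_empty_of_forall_notMem fun μ hμ => ?_
  have := (mem_down.1 hμ).card_eq
  rw [card_oneRow] at this
  omega

theorem down_oneRow_succ (a : ℕ) : down (oneRow (a + 1)) = {oneRow a} := by
  ext μ
  rw [mem_down, Finset.mem_singleton, covers_iff]
  simp only [rowLen_oneRow]
  constructor
  · rintro ⟨i, hi⟩
    have hi0 : i = 0 := by
      by_contra h
      have := hi i
      simp [h] at this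
    refine eq_of_rowLen_eq fun j => ?_
    have := hi j
    rw [rowLen_oneRow]
    split_ifs at this ⊢ <;> omega
  · rintro rfl
    refine ⟨0, fun j => ?_⟩
    rw [rowLen_oneRow]
    split_ifs <;> rfl

/-- The Stirling numbers arise by normal ordering the powers of `D U`, where `U D = D U + 1`, and
applying the result to a function at a one-row diagram. -/
theorem downOp_mul_upOp_pow_apply_oneRow (f : YoungDiagram → M) (n k : ℕ) :
    ((downOp M * upOp M) ^ k) f (oneRow n) =
      ∑ j ∈ Finset.range (n + 1), Nat.stirlingSecond k j • (upOp M ^ j) f (oneRow (n - j)) := by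
  induction k generalizing f with
  | zero =>
    rw [Finset.sum_range_succ']
    simp
  | succ k ih =>
    have h1 : ((downOp M * upOp M) ^ (k + 1)) f (oneRow n) =
        ∑ j ∈ Finset.range (n + 1), (Nat.stirlingSecond k j •
          downOp M ((upOp M ^ (j + 1)) f) (oneRow (n - j)) +
          (j * Nat.stirlingSecond k j) • (upOp M ^ j) f (oneRow (n - j))) := by
      rw [pow_succ, Module.End.mul_apply, ih]
      refine Finset.sum_congr rfl fun j _ => ?_
      rw [← Module.End.mul_apply, upOp_pow_mul_downOp_mul_upOp, LinearMap.add_apply,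
        Pi.add_apply, Module.End.mul_apply, LinearMap.smul_apply, Pi.smul_apply, smul_add,
        smul_smul, mul_comm]
    have h2 : ∑ j ∈ Finset.range (n + 1), Nat.stirlingSecond k j •
          downOp M ((upOp M ^ (j + 1)) f) (oneRow (n - j)) =
        ∑ j ∈ Finset.range n, Nat.stirlingSecond k j •
          (upOp M ^ (j + 1)) f (oneRow (n - (j + 1))) := by
      rw [Finset.sum_range_succ, Nat.sub_self, downOp_apply, down_oneRow_zero, Finset.sum_empty,
        smul_zero, add_zero]
      refine Finset.sum_congr rfl fun j hj => ?_
      have : n - j = n - (j + 1) + 1 := by have := Finset.mem_range.1 hj; omega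
      rw [this, downOp_apply, down_oneRow_succ, Finset.sum_singleton]
    rw [h1, Finset.sum_add_distrib, h2, Finset.sum_range_succ' _ n, Finset.sum_range_succ' _ n,
      ← add_assoc, ← Finset.sum_add_distrib]
    congr 1
    · refine Finset.sum_congr rfl fun j _ => ?_
      rw [← add_smul, Nat.stirlingSecond_succ_succ, add_comm]
    · simp

/-! ### Counting vacillating tableaux -/

/-- A vacillating tableau with a last step is one without it, together with the last two shapes. -/
def vacillatingTableauEquiv (n k : ℕ) (μ : YoungDiagram) :
    VacillatingTableau n (k + 1) μ ≃
      Σ ν : {ν // ν ∈ down μ}, Σ ρ : {ρ // ρ ∈ up ν.1}, VacillatingTableau n k ρ.1 where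
  toFun V := ⟨⟨V.half (Fin.last k), mem_down.2 ⟨by
      have := V.half_le_full_succ (Fin.last k)
      rwa [Fin.succ_last, V.full_last] at this, by
      have := V.card_add (Fin.last k)
      rwa [Fin.succ_last, V.full_last] at this⟩⟩,
    ⟨V.full (Fin.last k).castSucc, mem_up.2
      ⟨V.half_le_full (Fin.last k), V.card_remove (Fin.last k)⟩⟩,
    { full := fun j => V.full j.castSucc
      half := fun j => V.half j.castSucc
      full_zero := V.full_zero
      full_last := rfl
      half_le_full := fun j => V.half_le_full j.castSucc
      card_remove := fun j => V.card_remove j.castSucc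
      half_le_full_succ := fun j => V.half_le_full_succ j.castSucc
      card_add := fun j => V.card_add j.castSucc }⟩
  invFun W :=
    { full := Fin.snoc (α := fun _ => YoungDiagram) W.2.2.full μ
      half := Fin.snoc (α := fun _ => YoungDiagram) W.2.2.half W.1.1
      full_zero := by
        rw [← Fin.castSucc_zero, Fin.snoc_castSucc, W.2.2.full_zero]
      full_last := by rw [Fin.snoc_last]
      half_le_full := fun j => by
        refine Fin.lastCases ?_ (fun i => ?_) j
        · rw [Fin.snoc_last, Fin.snoc_castSucc, W.2.2.full_last]
          exact (mem_up.1 W.2.1.2).1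
        · rw [Fin.snoc_castSucc, Fin.snoc_castSucc]
          exact W.2.2.half_le_full i
      card_remove := fun j => by
        refine Fin.lastCases ?_ (fun i => ?_) j
        · rw [Fin.snoc_last, Fin.snoc_castSucc, W.2.2.full_last]
          exact (mem_up.1 W.2.1.2).2
        · rw [Fin.snoc_castSucc, Fin.snoc_castSucc]
          exact W.2.2.card_remove i
      half_le_full_succ := fun j => by
        refine Fin.lastCases ?_ (fun i => ?_) j
        · rw [Fin.snoc_last, Fin.succ_last, Fin.snoc_last]
          exact (mem_down.1 W.1.2).1
        · rw [Fin.snoc_castSucc, Fin.succ_castSucc, Fin.snoc_castSucc]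
          exact W.2.2.half_le_full_succ i
      card_add := fun j => by
        refine Fin.lastCases ?_ (fun i => ?_) j
        · rw [Fin.snoc_last, Fin.succ_last, Fin.snoc_last]
          exact (mem_down.1 W.1.2).2
        · rw [Fin.snoc_castSucc, Fin.succ_castSucc, Fin.snoc_castSucc]
          exact W.2.2.card_add i }
  left_inv V := by
    apply VacillatingTableau.ext
    · funext j
      refine Fin.lastCases ?_ (fun i => ?_) j
      · simp [V.full_last]
      · simp
    · funext j
      refine Fin.lastCases ?_ (fun i => ?_) j <;> simp
  right_inv := by
    have hext : ∀ x y : Σ ν : {ν // ν ∈ down μ}, Σ ρ : {ρ // ρ ∈ up ν.1},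
        VacillatingTableau n k ρ.1, x.1.1 = y.1.1 → x.2.1.1 = y.2.1.1 →
        x.2.2.full = y.2.2.full → x.2.2.half = y.2.2.half → x = y := by
      rintro ⟨⟨ν, hν⟩, ⟨ρ, hρ⟩, V⟩ ⟨⟨ν', hν'⟩, ⟨ρ', hρ'⟩, V'⟩ h1 h2 h3 h4
      dsimp only at h1 h2 V V' h3 h4
      subst h1 h2
      obtain rfl : V = V' := VacillatingTableau.ext h3 h4
      rfl
    intro W
    apply hext
    · simp
    · simp [W.2.2.full_last]
    · simp
    · simp

theorem numVT_zero (n : ℕ) (μ : YoungDiagram) [Decidable (μ = oneRow n)] :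
    numVT n 0 μ = if μ = oneRow n then 1 else 0 := by
  rw [numVT]
  split_ifs with h
  · subst h
    refine Nat.card_eq_one_iff_unique.2 ⟨⟨fun V W => ?_⟩, ⟨⟨fun _ => oneRow n, Fin.elim0, rfl, rfl,
      fun j => j.elim0, fun j => j.elim0, fun j => j.elim0, fun j => j.elim0⟩⟩⟩
    apply VacillatingTableau.ext
    · funext j
      rw [Subsingleton.elim (α := Fin 1) j 0, V.full_zero, W.full_zero]
    · funext j
      exact j.elim0
  · rw [Nat.card_eq_zero]
    exact Or.inl ⟨fun V => h (V.full_last.symm.trans V.full_zero)⟩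

theorem numVT_succ (n k : ℕ) (μ : YoungDiagram) :
    numVT n (k + 1) μ = ∑ ν ∈ down μ, ∑ ρ ∈ up ν, numVT n k ρ := by
  rw [numVT, Nat.card_congr (vacillatingTableauEquiv n k μ), Nat.card_sigma,
    ← Finset.sum_coe_sort (down μ)]
  refine Finset.sum_congr rfl fun ν _ => ?_
  rw [Nat.card_sigma, ← Finset.sum_coe_sort (up ν.1)]
  rfl

/-- The partitions of `n`. -/
noncomputable def partitionsOf (n : ℕ) : Finset YoungDiagram := (finite_card_eq n).toFinset

@[simp] theorem mem_partitionsOf {n : ℕ} {μ : YoungDiagram} :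
    μ ∈ partitionsOf n ↔ μ.card = n := by simp [partitionsOf]

theorem sum_partitionsOf_numVT_smul (f : YoungDiagram → M) (n k : ℕ) :
    ∑ μ ∈ partitionsOf n, numVT n k μ • f μ = ((downOp M * upOp M) ^ k) f (oneRow n) := by
  classical
  induction k generalizing f with
  | zero =>
    simp only [numVT_zero, ite_smul, one_smul, zero_smul]
    rw [Finset.sum_ite_eq', if_pos (mem_partitionsOf.2 (card_oneRow n))]
    rfl
  | succ k ih =>
    rw [pow_succ, Module.End.mul_apply, ← ih]
    simp only [numVT_succ, Module.End.mul_apply, downOp_apply, upOp_apply, Finset.sum_smul,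
      Finset.smul_sum]
    -- the two ends of a pair of steps `μ ⋗ ν ⋖ ρ` are exchanged
    simp only [Finset.sum_sigma']
    refine Finset.sum_bij' (fun x _ => ⟨x.2.2, x.2.1, x.1⟩) (fun x _ => ⟨x.2.2, x.2.1, x.1⟩)
      ?_ ?_ (fun _ _ => rfl) (fun _ _ => rfl) (fun _ _ => rfl) <;>
    · rintro ⟨μ, ν, ρ⟩ h
      simp only [Finset.mem_sigma, mem_partitionsOf, mem_down, mem_up] at h ⊢
      exact ⟨by rw [h.2.2.card_eq, ← h.2.1.card_eq, h.1], h.2.2, h.2.1⟩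

theorem le_rowLen_of_numVT_ne_zero {n k : ℕ} {μ : YoungDiagram} (h : numVT n k μ ≠ 0) :
    n ≤ μ.rowLen 0 + k := by
  classical
  induction k generalizing μ with
  | zero =>
    rw [numVT_zero] at h
    rw [of_not_not (mt (if_neg (α := ℕ) (t := 1)) h), rowLen_oneRow]
    simp
  | succ k ih =>
    rw [numVT_succ] at h
    obtain ⟨ν, hν, h⟩ := Finset.exists_ne_zero_of_sum_ne_zero h
    obtain ⟨ρ, hρ, h⟩ := Finset.exists_ne_zero_of_sum_ne_zero h
    have h1 := ih h
    obtain ⟨i, hi⟩ := covers_iff.1 (mem_up.1 hρ)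
    have h2 := hi 0
    have h3 := le_iff_rowLen_le.1 (mem_down.1 hν).1 0
    split_ifs at h2 <;> omega

theorem sum_Lam_numVT_smul (f : YoungDiagram → M) (n k : ℕ) :
    ∑ μ ∈ Lam n k, numVT n k μ • f μ = ((downOp M * upOp M) ^ k) f (oneRow n) := by
  rw [← sum_partitionsOf_numVT_smul]
  refine Finset.sum_subset (fun μ h => mem_partitionsOf.2 (mem_Lam.1 h).1) fun μ h1 h2 => ?_
  by_contra hne
  have := le_rowLen_of_numVT_ne_zero (left_ne_zero_of_smul hne)
  exact h2 (mem_Lam.2 ⟨mem_partitionsOf.1 h1, by omega⟩)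

/-! ### Branching of semistandard tableaux and Pieri's rule -/

theorem PosSSYT.content_apply {μ : YoungDiagram} (T : PosSSYT μ) (i : ℕ+) :
    T.content i = (μ.cells.filter fun c => T.1 c.1 c.2 = i).card := by
  rw [PosSSYT.content, Finsupp.finsetSum_apply, Finset.card_filter, ← Finset.sum_coe_sort μ.cells]
  refine Finset.sum_congr rfl fun c _ => ?_
  rw [Finsupp.single_apply]
  exact if_congr PNat.coe_inj.symm rfl rfl

theorem PosSSYT.degree_content {μ : YoungDiagram} (T : PosSSYT μ) :
    T.content.degree = μ.card := by
  rw [PosSSYT.content, map_sum]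
  simp [YoungDiagram.card]

theorem PosSSYT.mem_support_content {μ : YoungDiagram} (T : PosSSYT μ) {c : ℕ × ℕ} (hc : c ∈ μ) :
    ∃ i ∈ T.content.support, T.1 c.1 c.2 = i := by
  refine ⟨Nat.toPNat (T.1 c.1 c.2) (T.2 c hc), ?_, rfl⟩
  rw [Finsupp.mem_support_iff, PosSSYT.content_apply]
  exact Finset.card_ne_zero_of_mem (Finset.mem_filter.2 ⟨hc, rfl⟩)

/-- The number of semistandard Young tableaux of shape `μ` and content `d`. -/
noncomputable def kostka (μ : YoungDiagram) (d : ℕ+ →₀ ℕ) : ℕ :=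
  Nat.card {T : PosSSYT μ // T.content = d}

theorem kostka_eq_zero {μ : YoungDiagram} {d : ℕ+ →₀ ℕ} (h : μ.card ≠ d.degree) :
    kostka μ d = 0 := by
  rw [kostka, Nat.card_eq_zero]
  refine Or.inl ⟨fun T => h ?_⟩
  rw [← T.2, PosSSYT.degree_content]

namespace PosSSYT

variable {κ ρ : YoungDiagram}

/-- The cells of a tableau with entries below `m`. -/
def inner (T : PosSSYT ρ) (m : ℕ) : YoungDiagram where
  cells := ρ.cells.filter fun c => T.1 c.1 c.2 < m
  isLowerSet := by
    rintro ⟨i, j⟩ ⟨i', j'⟩ ⟨h1 : i' ≤ i, h2 : j' ≤ j⟩ h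
    simp only [Finset.coe_filter, Set.mem_ofPred_eq, YoungDiagram.mem_cells] at h ⊢
    exact ⟨ρ.up_left_mem h1 h2 h.1, ((T.1.col_weak h1 (ρ.up_left_mem le_rfl h2 h.1)).trans
      (T.1.row_weak_of_le h2 h.1)).trans_lt h.2⟩

theorem mem_inner {T : PosSSYT ρ} {m : ℕ} {c : ℕ × ℕ} :
    c ∈ T.inner m ↔ c ∈ ρ ∧ T.1 c.1 c.2 < m := by
  rw [← YoungDiagram.mem_cells, inner, Finset.mem_filter, YoungDiagram.mem_cells]

theorem hStrip_inner (T : PosSSYT ρ) {m : ℕ} (hm : ∀ c ∈ ρ, T.1 c.1 c.2 ≤ m) :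
    HStrip (T.inner m) ρ := by
  refine ⟨fun c hc => (mem_inner.1 hc).1, fun i j h => mem_inner.2
    ⟨ρ.up_left_mem (Nat.le_succ i) le_rfl h, ?_⟩⟩
  exact (T.1.col_strict (Nat.lt_succ_self i) h).trans_le (hm _ h)

open Classical in
/-- The restriction of a tableau to a smaller diagram. -/
noncomputable def restrict (T : PosSSYT ρ) (h : κ ≤ ρ) : PosSSYT κ :=
  ⟨{ entry := fun i j => if (i, j) ∈ κ then T.1 i j else 0
     row_weak' := fun {i j1 j2} hj hc => by
      rw [if_pos hc, if_pos (κ.up_left_mem le_rfl hj.le hc)]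
      exact T.1.row_weak hj (h hc)
     col_strict' := fun {i1 i2 j} hi hc => by
      rw [if_pos hc, if_pos (κ.up_left_mem hi.le le_rfl hc)]
      exact T.1.col_strict hi (h hc)
     zeros' := fun hc => if_neg hc },
   fun c hc => (T.2 c (h hc)).trans_eq (if_pos hc).symm⟩

theorem restrict_apply (T : PosSSYT ρ) (h : κ ≤ ρ) {i j : ℕ} (hc : (i, j) ∈ κ) :
    (T.restrict h).1 i j = T.1 i j := if_pos hc

open Classical in
/-- The extension of a tableau by a horizontal strip filled with a new largest entry `m`. -/
noncomputable def extend (T : PosSSYT κ) (h : HStrip κ ρ) (m : ℕ)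
    (hm : ∀ c ∈ κ, T.1 c.1 c.2 < m) (hm0 : 0 < m) : PosSSYT ρ :=
  ⟨{ entry := fun i j => if (i, j) ∈ κ then T.1 i j else if (i, j) ∈ ρ then m else 0
     row_weak' := fun {i j1 j2} hj hc => by
      by_cases h2 : (i, j2) ∈ κ
      · rw [if_pos h2, if_pos (κ.up_left_mem le_rfl hj.le h2)]
        exact T.1.row_weak hj h2
      · rw [if_neg h2, if_pos hc, if_pos (ρ.up_left_mem le_rfl hj.le hc)]
        split_ifs with h1
        · exact (hm _ h1).le
        · exact le_rfl
     col_strict' := fun {i1 i2 j} hi hc => by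
      have h1 : (i1, j) ∈ κ := h.2 _ _ (ρ.up_left_mem hi le_rfl hc)
      rw [if_pos h1]
      split_ifs with h2
      · exact T.1.col_strict hi h2
      · exact hm _ h1
     zeros' := fun hc => by rw [if_neg fun h' => hc (h.1 h'), if_neg hc] },
   fun c hc => by
    change 0 < if c ∈ κ then T.1 c.1 c.2 else if c ∈ ρ then m else 0
    split_ifs with h1 h2
    · exact T.2 c h1
    · exact hm0
    · exact absurd hc h2⟩

theorem extend_apply_of_mem (T : PosSSYT κ) (h : HStrip κ ρ) {m : ℕ}
    (hm : ∀ c ∈ κ, T.1 c.1 c.2 < m) (hm0 : 0 < m) {i j : ℕ} (hc : (i, j) ∈ κ) :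
    (T.extend h m hm hm0).1 i j = T.1 i j := if_pos hc

theorem extend_apply_of_notMem (T : PosSSYT κ) (h : HStrip κ ρ) {m : ℕ}
    (hm : ∀ c ∈ κ, T.1 c.1 c.2 < m) (hm0 : 0 < m) {i j : ℕ} (hc : (i, j) ∉ κ)
    (hc' : (i, j) ∈ ρ) :
    (T.extend h m hm hm0).1 i j = m := (if_neg hc).trans (if_pos hc')

theorem inner_extend (T : PosSSYT κ) (h : HStrip κ ρ) {m : ℕ}
    (hm : ∀ c ∈ κ, T.1 c.1 c.2 < m) (hm0 : 0 < m) : (T.extend h m hm hm0).inner m = κ := by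
  ext ⟨i, j⟩
  rw [YoungDiagram.mem_cells, YoungDiagram.mem_cells, mem_inner]
  by_cases hc : (i, j) ∈ κ
  · simp only [extend_apply_of_mem T h hm hm0 hc, hc, iff_true]
    exact ⟨h.1 hc, hm _ hc⟩
  · simp only [hc, iff_false, not_and]
    intro hc'
    rw [extend_apply_of_notMem T h hm hm0 hc hc']
    exact lt_irrefl m

theorem content_restrict_inner (T : PosSSYT ρ) (m : ℕ+) (h : T.inner m ≤ ρ)
    (hm : ∀ c ∈ ρ, T.1 c.1 c.2 ≤ m) : (T.restrict h).content = T.content.erase m := by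
  ext i
  rw [content_apply, Finsupp.erase_apply]
  split_ifs with hi
  · rw [Finset.card_eq_zero, Finset.filter_eq_empty_iff]
    rintro ⟨a, b⟩ hc
    rw [restrict_apply T h hc, hi]
    exact (mem_inner.1 hc).2.ne
  · rw [content_apply]
    congr 1
    ext ⟨a, b⟩
    simp only [Finset.mem_filter, YoungDiagram.mem_cells]
    constructor
    · rintro ⟨hc, e⟩
      rw [restrict_apply T h hc] at e
      exact ⟨h hc, e⟩
    · rintro ⟨hc, e⟩
      have hc' : (a, b) ∈ T.inner m := mem_inner.2
        ⟨hc, (hm _ hc).lt_of_ne fun h' => hi (PNat.coe_inj.1 (e.symm.trans h'))⟩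
      exact ⟨hc', by rw [restrict_apply T h hc', e]⟩

theorem content_extend (T : PosSSYT κ) (h : HStrip κ ρ) {m : ℕ+}
    (hm : ∀ c ∈ κ, T.1 c.1 c.2 < m) {d : ℕ+ →₀ ℕ} (hT : T.content = d.erase m)
    (hd : ρ.card = d.degree) : (T.extend h m hm m.pos).content = d := by
  have hne : ∀ i ≠ m, (T.extend h m hm m.pos).content i = d i := by
    intro i hi
    rw [← Finsupp.erase_ne (f := d) hi, ← hT, content_apply, content_apply]
    congr 1
    ext ⟨a, b⟩
    simp only [Finset.mem_filter, YoungDiagram.mem_cells]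
    constructor
    · rintro ⟨hc, e⟩
      by_cases hc' : (a, b) ∈ κ
      · rw [extend_apply_of_mem T h hm m.pos hc'] at e
        exact ⟨hc', e⟩
      · rw [extend_apply_of_notMem T h hm m.pos hc' hc] at e
        exact absurd (PNat.coe_inj.1 e).symm hi
    · rintro ⟨hc, e⟩
      exact ⟨h.1 hc, by rw [extend_apply_of_mem T h hm m.pos hc, e]⟩
  have herase : (T.extend h m hm m.pos).content.erase m = d.erase m := by
    ext i
    rw [Finsupp.erase_apply, Finsupp.erase_apply]
    split_ifs with hi
    · rfl
    · exact hne i hi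
  -- the multiplicity of `m` is determined by the total degree
  have hdeg := (degree_content (T.extend h m hm m.pos)).trans hd
  rw [← Finsupp.single_add_erase m d, ← Finsupp.single_add_erase m
    (T.extend h m hm m.pos).content, herase, map_add, map_add, Finsupp.degree_single,
    Finsupp.degree_single] at hdeg
  ext i
  by_cases hi : i = m
  · subst hi
    exact Nat.add_right_cancel hdeg
  · exact hne i hi

theorem entry_le_of_content {T : PosSSYT ρ} {d : ℕ+ →₀ ℕ} (hT : T.content = d) {m : ℕ+}
    (hd : ∀ i ∈ d.support, i ≤ m) : ∀ c ∈ ρ, T.1 c.1 c.2 ≤ m := by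
  intro c hc
  obtain ⟨i, hi, e⟩ := T.mem_support_content hc
  rw [e]
  exact hd i (hT ▸ hi)

theorem entry_lt_of_content_erase {T : PosSSYT κ} {d : ℕ+ →₀ ℕ} {m : ℕ+}
    (hT : T.content = d.erase m) (hd : ∀ i ∈ d.support, i ≤ m) : ∀ c ∈ κ, T.1 c.1 c.2 < m := by
  intro c hc
  obtain ⟨i, hi, e⟩ := T.mem_support_content hc
  rw [hT, Finsupp.support_erase, Finset.mem_erase] at hi
  rw [e]
  exact (hd i hi.2).lt_of_ne hi.1

/-- Tableaux of content `d` whose entries below the largest value `m` fill `κ` correspond, by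
forgetting the cells with entry `m`, to tableaux of shape `κ`. -/
noncomputable def innerFiberEquiv (h : HStrip κ ρ) {d : ℕ+ →₀ ℕ} {m : ℕ+}
    (hd : ∀ i ∈ d.support, i ≤ m) (hc : ρ.card = d.degree) :
    {T : {T : PosSSYT ρ // T.content = d} // T.1.inner m = κ} ≃
      {T : PosSSYT κ // T.content = d.erase m} where
  toFun T := ⟨T.1.1.restrict h.1, by
    obtain ⟨⟨T, hT⟩, rfl⟩ := T
    rw [content_restrict_inner T m h.1 (entry_le_of_content hT hd), hT]⟩
  invFun T := ⟨⟨T.1.extend h m (entry_lt_of_content_erase T.2 hd) m.pos,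
    content_extend T.1 h _ T.2 hc⟩, inner_extend T.1 h (entry_lt_of_content_erase T.2 hd) m.pos⟩
  left_inv := by
    rintro ⟨⟨T, hT⟩, hκ⟩
    refine Subtype.ext (Subtype.ext (Subtype.ext ?_))
    ext i j
    by_cases h1 : (i, j) ∈ ρ
    · by_cases h2 : (i, j) ∈ κ
      · rw [extend_apply_of_mem _ _ _ _ h2, restrict_apply _ _ h2]
      · rw [extend_apply_of_notMem _ _ _ _ h2 h1]
        refine le_antisymm (not_lt.1 fun hlt => h2 (hκ ▸ mem_inner.2 ⟨h1, hlt⟩)) ?_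
        exact entry_le_of_content hT hd _ h1
    · rw [T.1.zeros h1, SemistandardYoungTableau.zeros _ h1]
  right_inv := by
    rintro ⟨T, hT⟩
    refine Subtype.ext (Subtype.ext ?_)
    ext i j
    by_cases h1 : (i, j) ∈ κ
    · rw [restrict_apply _ _ h1, extend_apply_of_mem _ _ _ _ h1]
    · rw [T.1.zeros h1, SemistandardYoungTableau.zeros _ h1]

end PosSSYT

/-- The branching rule: the cells holding the largest entry `m` form a horizontal strip. -/
theorem kostka_branching {ρ : YoungDiagram} {d : ℕ+ →₀ ℕ} {m : ℕ+}
    (hd : ∀ i ∈ d.support, i ≤ m) (hc : ρ.card = d.degree) :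
    kostka ρ d = ∑ κ ∈ strips ρ, kostka κ (d.erase m) := by
  let F : {T : PosSSYT ρ // T.content = d} → {κ // κ ∈ strips ρ} := fun T =>
    ⟨T.1.inner m, mem_strips.2 (T.1.hStrip_inner (PosSSYT.entry_le_of_content T.2 hd))⟩
  rw [kostka, Nat.card_congr (Equiv.sigmaFiberEquiv F).symm, Nat.card_sigma,
    ← Finset.sum_coe_sort (strips ρ)]
  refine Finset.sum_congr rfl fun κ _ => ?_
  rw [kostka, ← Nat.card_congr (PosSSYT.innerFiberEquiv (mem_strips.1 κ.2) hd hc)]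
  exact Nat.card_congr (Equiv.subtypeEquivRight fun T => Subtype.ext_iff)

theorem degree_sub_single {d : ℕ+ →₀ ℕ} {i : ℕ+} (hi : i ∈ d.support) :
    (d - Finsupp.single i 1).degree + 1 = d.degree := by
  have h : Finsupp.single i 1 ≤ d := Finsupp.single_le_iff.2
    (Nat.one_le_iff_ne_zero.2 (Finsupp.mem_support_iff.1 hi))
  conv_rhs => rw [← tsub_add_cancel_of_le h, map_add, Finsupp.degree_single]

/-- Pieri's rule for adding one cell, in terms of coefficients. The induction is on a bound for the
variables that occur, which removes the largest variable by the branching rule. -/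
theorem sum_up_kostka (ν : YoungDiagram) (d : ℕ+ →₀ ℕ) :
    ∑ ρ ∈ up ν, kostka ρ d = ∑ i ∈ d.support, kostka ν (d - Finsupp.single i 1) := by
  obtain ⟨m, hm⟩ : ∃ m : ℕ, ∀ i ∈ d.support, (i : ℕ) ≤ m :=
    ⟨d.support.sup (fun i => (i : ℕ)), fun i hi => Finset.le_sup (f := fun i : ℕ+ => (i : ℕ)) hi⟩
  induction m generalizing ν d with
  | zero =>
    have hs : d.support = ∅ := Finset.eq_empty_of_forall_notMem fun i hi =>
      absurd (hm i hi) (not_le.2 i.pos)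
    have hd : d = 0 := Finsupp.support_eq_empty.1 hs
    rw [hs, Finset.sum_empty]
    refine Finset.sum_eq_zero fun ρ hρ => kostka_eq_zero ?_
    rw [(mem_up.1 hρ).card_eq, hd, map_zero]
    exact Nat.succ_ne_zero _
  | succ m ih =>
    by_cases hc : ν.card + 1 = d.degree
    swap
    · rw [Finset.sum_eq_zero fun ρ hρ => kostka_eq_zero (by rwa [(mem_up.1 hρ).card_eq]),
        Finset.sum_eq_zero fun i hi => kostka_eq_zero fun h => hc (by
          rw [h, degree_sub_single hi])]
    obtain ⟨p, hp⟩ : ∃ p : ℕ+, (p : ℕ) = m + 1 := ⟨⟨m + 1, Nat.succ_pos m⟩, rfl⟩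
    have hd : ∀ i ∈ d.support, i ≤ p := fun i hi =>
      (PNat.coe_le_coe _ _).1 (hp ▸ hm i hi)
    have hd' : ∀ i ∈ (d.erase p).support, (i : ℕ) ≤ m := by
      intro i hi
      rw [Finsupp.support_erase, Finset.mem_erase] at hi
      have h1 := hm i hi.2
      have h2 : (i : ℕ) ≠ m + 1 := fun h => hi.1 (PNat.coe_inj.1 (h.trans hp.symm))
      omega
    have hleft : ∑ ρ ∈ up ν, kostka ρ d =
        ∑ i ∈ (d.erase p).support, ∑ μ ∈ strips ν, kostka μ (d.erase p - Finsupp.single i 1) +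
        ∑ κ ∈ strips ν, kostka κ (d.erase p) := by
      rw [Finset.sum_congr rfl fun ρ hρ => kostka_branching hd (by rwa [(mem_up.1 hρ).card_eq]),
        sum_up_sum_strips, Finset.sum_comm]
      exact congrArg (· + _) (Finset.sum_congr rfl fun μ _ => ih μ _ hd')
    have hright : ∀ i ∈ d.support, kostka ν (d - Finsupp.single i 1) =
        ∑ μ ∈ strips ν, kostka μ ((d - Finsupp.single i 1).erase p) := by
      intro i hi
      refine kostka_branching (fun a ha => hd a ?_) ?_
      · exact Finsupp.support_mono tsub_le_self ha
      · have := degree_sub_single hi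
        omega
    have hne : ∀ i ∈ (d.erase p).support,
        (d - Finsupp.single i 1).erase p = d.erase p - Finsupp.single i 1 := by
      intro i hi
      rw [Finsupp.support_erase, Finset.mem_erase] at hi
      ext a
      simp only [Finsupp.erase_apply, Finsupp.tsub_apply, Finsupp.single_apply]
      split_ifs <;> simp_all
    have heq : (d - Finsupp.single p 1).erase p = d.erase p := by
      ext a
      simp only [Finsupp.erase_apply, Finsupp.tsub_apply, Finsupp.single_apply]
      split_ifs <;> simp_all
    rw [hleft, Finset.sum_congr rfl hright]
    by_cases hmem : p ∈ d.support
    · rw [← Finset.sum_erase_add _ _ hmem, heq, ← Finsupp.support_erase]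
      congr 1
      exact Finset.sum_congr rfl fun i hi => by rw [hne i hi]
    · -- the extra sum over `strips ν` vanishes, as its shapes are smaller than the degree of `d`
      have hde : d.erase p = d := Finsupp.erase_of_notMem_support hmem
      rw [Finset.sum_eq_zero fun κ hκ => kostka_eq_zero (d := d.erase p) ?_, add_zero]
      · rw [hde] at hne ⊢
        exact Finset.sum_congr rfl fun i hi => by rw [hne i hi]
      · have := (mem_strips.1 hκ).card_le
        rw [hde]
        omega

/-! ### Schur functions and complete symmetric functions -/

theorem coeff_schur (μ : YoungDiagram) (d : ℕ+ →₀ ℕ) :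
    MvPowerSeries.coeff d (schur μ) = (kostka μ d : ℤ) := rfl

theorem coeff_complete_one_single (i : ℕ+) :
    MvPowerSeries.coeff (Finsupp.single i 1) (complete 1) = 1 := by
  change ((Nat.card _ : ℕ) : ℤ) = 1
  rw [Nat.cast_eq_one, Nat.card_eq_one_iff_unique]
  refine ⟨⟨fun a b => ?_⟩, ⟨⟨⟨fun _ => i, monotone_const⟩, by simp⟩⟩⟩
  have : ∀ a : {a : {a : Fin 1 → ℕ+ // Monotone a} //
      ∑ t, Finsupp.single (a.1 t) 1 = Finsupp.single i 1}, ∀ t, a.1.1 t = i := by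
    intro a t
    have h := a.2
    rw [Fin.sum_univ_one] at h
    rw [Subsingleton.elim t 0]
    exact Finsupp.single_left_injective one_ne_zero h
  exact Subtype.ext (Subtype.ext (funext fun t => by rw [this a, this b]))

theorem coeff_complete_one_eq_zero {d : ℕ+ →₀ ℕ} (hd : ∀ i, d ≠ Finsupp.single i 1) :
    MvPowerSeries.coeff d (complete 1) = 0 := by
  change ((Nat.card _ : ℕ) : ℤ) = 0
  rw [Nat.cast_eq_zero, Nat.card_eq_zero]
  refine Or.inl ⟨fun a => hd (a.1.1 0) ?_⟩
  exact a.2.symm.trans (Fin.sum_univ_one _)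

theorem coeff_complete_one_mul (f : MvPowerSeries ℕ+ ℤ) (d : ℕ+ →₀ ℕ) :
    MvPowerSeries.coeff d (complete 1 * f) =
      ∑ i ∈ d.support, MvPowerSeries.coeff (d - Finsupp.single i 1) f := by
  classical
  rw [MvPowerSeries.coeff_mul]
  have hsub : d.support.image (fun i => (Finsupp.single i 1, d - Finsupp.single i 1)) ⊆
      Finset.HasAntidiagonal.antidiagonal d := by
    intro x hx
    obtain ⟨i, hi, rfl⟩ := Finset.mem_image.1 hx
    rw [Finset.HasAntidiagonal.mem_antidiagonal]
    exact add_tsub_cancel_of_le (Finsupp.single_le_iff.2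
      (Nat.one_le_iff_ne_zero.2 (Finsupp.mem_support_iff.1 hi)))
  rw [← Finset.sum_subset hsub, Finset.sum_image]
  · refine Finset.sum_congr rfl fun i _ => ?_
    rw [coeff_complete_one_single, one_mul]
  · intro i _ j _ h
    exact Finsupp.single_left_injective one_ne_zero (congrArg Prod.fst h)
  · rintro ⟨a, b⟩ hab hn
    rw [coeff_complete_one_eq_zero, zero_mul]
    rintro i rfl
    rw [Finset.HasAntidiagonal.mem_antidiagonal] at hab
    refine hn (Finset.mem_image.2 ⟨i, ?_, ?_⟩)
    · rw [← hab, Finsupp.mem_support_iff]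
      simp
    · rw [← hab, add_tsub_cancel_left]

/-- Pieri's rule for multiplication by `h_1`. -/
theorem upOp_schur : upOp (MvPowerSeries ℕ+ ℤ) schur = fun ν => complete 1 * schur ν := by
  funext ν
  ext d
  rw [upOp_apply, map_sum, coeff_complete_one_mul]
  simp only [coeff_schur]
  exact_mod_cast sum_up_kostka ν d

theorem upOp_pow_schur (j : ℕ) (ν : YoungDiagram) :
    (upOp (MvPowerSeries ℕ+ ℤ) ^ j) schur ν = complete 1 ^ j * schur ν := by
  induction j generalizing ν with
  | zero => simp
  | succ j ih =>
    rw [pow_succ', Module.End.mul_apply, funext ih, upOp_apply, ← Finset.mul_sum, ← upOp_apply,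
      upOp_schur, pow_succ, mul_assoc]

theorem mem_oneRow {a i j : ℕ} : (i, j) ∈ oneRow a ↔ i = 0 ∧ j < a := by
  rw [YoungDiagram.mem_iff_lt_rowLen, rowLen_oneRow]
  split_ifs with h <;> simp [h]

/-- Semistandard tableaux with one row are weakly increasing sequences. -/
noncomputable def oneRowEquiv (a : ℕ) :
    PosSSYT (oneRow a) ≃ {i : Fin a → ℕ+ // Monotone i} where
  toFun T := ⟨fun t => Nat.toPNat (T.1 0 t) (T.2 (0, t) (mem_oneRow.2 ⟨rfl, t.2⟩)), fun s t h =>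
    T.1.row_weak_of_le h (mem_oneRow.2 ⟨rfl, t.2⟩)⟩
  invFun f := ⟨{
    entry := fun i j => if h : i = 0 ∧ j < a then f.1 ⟨j, h.2⟩ else 0
    row_weak' := fun {i j1 j2} hj hc => by
      rw [mem_oneRow] at hc
      rw [dif_pos hc, dif_pos ⟨hc.1, hj.trans hc.2⟩]
      exact f.2 hj.le
    col_strict' := fun {i1 i2 j} hi hc => by
      rw [mem_oneRow] at hc
      omega
    zeros' := fun hc => dif_neg (mt mem_oneRow.2 hc) }, fun c hc => by
    change 0 < if h : c.1 = 0 ∧ c.2 < a then (f.1 ⟨c.2, h.2⟩ : ℕ) else 0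
    rw [dif_pos (mem_oneRow.1 hc)]
    exact PNat.pos _⟩
  left_inv T := by
    refine Subtype.ext ?_
    ext i j
    change (if h : i = 0 ∧ j < a then T.1 0 j else 0) = T.1 i j
    split_ifs with h
    · rw [h.1]
    · exact (T.1.zeros (mt mem_oneRow.1 h)).symm
  right_inv f := by
    refine Subtype.ext (funext fun t => PNat.coe_inj.1 ?_)
    exact dif_pos ⟨rfl, t.2⟩

theorem sum_single_oneRowEquiv {a : ℕ} (T : PosSSYT (oneRow a)) :
    ∑ t, Finsupp.single ((oneRowEquiv a T).1 t) 1 = T.content := by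
  rw [PosSSYT.content]
  refine Fintype.sum_bijective
    (fun t : Fin a => (⟨(0, t), mem_oneRow.2 ⟨rfl, t.2⟩⟩ : {c // c ∈ (oneRow a).cells})) ⟨?_, ?_⟩ _ _
    fun t => rfl
  · intro s t h
    simpa [Fin.ext_iff] using h
  · rintro ⟨⟨i, j⟩, h⟩
    obtain ⟨rfl, hj⟩ := mem_oneRow.1 h
    exact ⟨⟨j, hj⟩, rfl⟩

theorem schur_oneRow (a : ℕ) : schur (oneRow a) = complete a := by
  funext d
  refine congrArg Nat.cast (Nat.card_congr ((oneRowEquiv a).subtypeEquiv fun T => ?_))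
  beta_reduce
  rw [sum_single_oneRowEquiv]

theorem complete_zero : complete 0 = 1 := by
  classical
  ext d
  rw [MvPowerSeries.coeff_one]
  change ((Nat.card _ : ℕ) : ℤ) = _
  split_ifs with h
  · rw [Nat.cast_eq_one, Nat.card_eq_one_iff_unique]
    exact ⟨⟨fun a b => Subtype.ext (Subtype.ext (Subsingleton.elim _ _))⟩,
      ⟨⟨⟨Fin.elim0, fun i => i.elim0⟩, by simp [h]⟩⟩⟩
  · rw [Nat.cast_eq_zero, Nat.card_eq_zero]
    exact Or.inl ⟨fun a => h (by simpa using a.2.symm)⟩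

theorem completePart_hook (a j : ℕ) :
    completePart (hook a j) = complete 1 ^ j * complete a := by
  rw [completePart, hook, YoungDiagram.rowLens_ofRowLens_eq_self]
  · split_ifs with h
    · rw [h, complete_zero, mul_one, List.map_replicate, List.prod_replicate]
    · rw [List.map_cons, List.prod_cons, List.map_replicate, List.prod_replicate, mul_comm]
  · intro x hx
    split_ifs at hx with h
    · rw [List.eq_of_mem_replicate hx]
      exact one_pos
    · rcases List.mem_cons.1 hx with rfl | hx
      · exact Nat.pos_of_ne_zero h
      · rw [List.eq_of_mem_replicate hx]
        exact one_pos

end VacTab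

theorem mainTheorem1 (n k : ℕ) (hn : 1 ≤ n) :
    ∑ μ ∈ VacTab.Lam n k, (VacTab.numVT n k μ : MvPowerSeries ℕ+ ℤ) * VacTab.schur μ =
      ∑ j ∈ Finset.range (min n k + 1),
        (Nat.stirlingSecond k j : MvPowerSeries ℕ+ ℤ) * VacTab.completePart (VacTab.hook (n - j) j) := by
  simp only [← nsmul_eq_mul]
  rw [VacTab.sum_Lam_numVT_smul VacTab.schur, VacTab.downOp_mul_upOp_pow_apply_oneRow]
  simp only [VacTab.completePart_hook, VacTab.upOp_pow_schur, VacTab.schur_oneRow]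
  refine (Finset.sum_subset (Finset.range_subset_range.2 (by omega)) fun j h1 h2 => ?_).symm
  rw [Finset.mem_range] at h1 h2
  rw [Nat.stirlingSecond_eq_zero_of_lt (by omega), zero_smul]
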